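/- Let $X$ be a Banach space over $\mathbb{R}$ or $\mathbb{C}$ and let $T : X \to X$ be a bounded linear operator that is mean-bounded, i.e. $\sup_{N \ge 1} \|M_N(T)\| < \infty$, where $M_N(T) = \frac{1}{N}\sum_{n=0}^{N-1} T^n$. (No positivity of $T$ is assumed.) Let $\psi(x) = \frac{1-\sqrt{1-x}}{x}$, with $\psi(0) = \frac12$, and let $\psi(x) = \sum_{p=0}^{\infty} \alpha_p x^p$ be its Taylor series at $0$. Then the Brunel operator $A = \psi(T) = \sum_{p=0}^{\infty} \alpha_p T^p$ is well defined: there is exactly one bounded linear operator $A$ on $X$ such that $$\lim_{N \to \infty} \sum_{p=0}^{N} \alpha_p T^p f = A f \qquad \text{for every } f \in X.$$ Moreover $A$ is power-bounded, i.e. $\sup_{n} \|A^n\| < \infty$, and there is a constant $C < \infty$ such that $$\sup_{n \in \mathbb{N}} n\,\|A^{n+1} - A^n\| \le C.$$ -/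

import Mathlib

open Filter Topology

/-- The function `ψ(x) = (1 - √(1 - x)) / x`, with its limit `1/2` as value at `x = 0`.
It is used only near `0` (where `1 - x > 0`). -/
noncomputable def brunelPsi (x : ℝ) : ℝ :=
  if x = 0 then 1 / 2 else (1 - Real.sqrt (1 - x)) / x

/-- The `p`-th Taylor coefficient `α_p` of `ψ` at `0`, i.e. `ψ(x) = ∑ α_p x ^ p` near `0`. -/
noncomputable def brunelCoeff (p : ℕ) : ℝ :=
  iteratedDeriv p brunelPsi 0 / (p.factorial : ℝ)

/-- The Cesàro average `M_N(T) = (1 / N) (I + T + ⋯ + T ^ (N - 1))` (meaningful for `N ≥ 1`). -/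
noncomputable def cesaroMean {𝕜 X : Type*} [RCLike 𝕜] [NormedAddCommGroup X] [NormedSpace 𝕜 X]
    (T : X →L[𝕜] X) (N : ℕ) : X →L[𝕜] X :=
  (N : 𝕜)⁻¹ • ∑ n ∈ Finset.range N, T ^ n

/-- `T` is mean-bounded: `sup_{N ≥ 1} ‖M_N(T)‖ < ∞`. -/
def IsMeanBounded {𝕜 X : Type*} [RCLike 𝕜] [NormedAddCommGroup X] [NormedSpace 𝕜 X]
    (T : X →L[𝕜] X) : Prop :=
  ∃ M : ℝ, ∀ N : ℕ, 1 ≤ N → ‖cesaroMean T N‖ ≤ M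

/-- `T` is power-bounded: `sup_n ‖T ^ n‖ < ∞`. -/
def IsPowerBounded {𝕜 X : Type*} [RCLike 𝕜] [NormedAddCommGroup X] [NormedSpace 𝕜 X]
    (T : X →L[𝕜] X) : Prop :=
  ∃ M : ℝ, ∀ n : ℕ, ‖T ^ n‖ ≤ M

/-- `A` is the Brunel operator `ψ(T) = ∑ α_p T ^ p`: the bounded operator `A` is the limit, in the
strong operator topology, of the partial sums of the series. -/
def IsBrunelOperator {𝕜 X : Type*} [RCLike 𝕜] [NormedAddCommGroup X] [NormedSpace 𝕜 X]
    (T A : X →L[𝕜] X) : Prop :=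
  ∀ f : X, Tendsto (fun N : ℕ => ∑ p ∈ Finset.range (N + 1), (brunelCoeff p : 𝕜) • (T ^ p) f)
    atTop (𝓝 (A f))

/-! Mean-boundedness says that `∑ k < P, T ^ k` has norm at most `M * P`. Summation by parts then
bounds `∑ a p • T ^ p` by `M * ∑ (p + 1) * |a p - a (p + 1)|` whenever `p * a p → 0`. So positivity
of `T` is not needed, only weighted variation bounds on scalar sequences.

The coefficients `b_m(p)` of `ψ ^ (m + 1)` have a closed form whose ratios in `m` and `p` are
rational. Hence the differences of `b_m` are `b_m` times rational functions, and with `y = (m + 1)(m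
+ 2)`, `s = m + p + 2` they are dominated by `b_m`, `y b_m / s` and `y² b_m / (s (s + 1))`.
Telescoping identities bound the sums of these by 1, 2 and 12 up to vanishing remainders. The
variation of `b_m` is thus at most 2 (power-boundedness), that of `b_{m+1} - b_m` at most `9 / (m +
1)` (the difference estimate).

That `A ^ (m + 1) = ∑ b_m(p) T ^ p` follows from `x ψ² = 2 ψ - 1` and from Abel's theorem on Cauchy
products (`mul_eq_of_tendsto_cauchyProduct`), as the operator series need not converge absolutely.
-/

open Finset.HasAntidiagonal (antidiagonal mem_antidiagonal)

/-! ### Closed form of the coefficients and its ratios. -/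

/-- The `p`-th Taylor coefficient of `ψ ^ (m + 1)` at `0`. -/
noncomputable def brunelPowCoeff (m p : ℕ) : ℝ :=
  ((m : ℝ) + 1) * (m + 2 * p).factorial /
    (p.factorial * (m + 1 + p).factorial * 2 ^ (m + 1 + 2 * p))

theorem brunelPowCoeff_pos (m p : ℕ) : 0 < brunelPowCoeff m p := by
  unfold brunelPowCoeff; positivity

theorem brunelPowCoeff_succ_right (m p : ℕ) :
    brunelPowCoeff m (p + 1) = brunelPowCoeff m p *
      (((m : ℝ) + 1 + 2 * p) * (m + 2 * p + 2) / (4 * (p + 1) * (m + p + 2))) := by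
  unfold brunelPowCoeff
  rw [show m + 2 * (p + 1) = (m + 2 * p + 1) + 1 by ring,
    show m + 1 + (p + 1) = (m + 1 + p) + 1 by ring,
    show m + 1 + 2 * (p + 1) = m + 1 + 2 * p + 2 by ring, Nat.factorial_succ, Nat.factorial_succ,
    Nat.factorial_succ, Nat.factorial_succ, pow_add _ _ 2]
  have : (m : ℝ) + p + 2 ≠ 0 := by positivity
  have : (m : ℝ) + 1 + p + 1 ≠ 0 := by positivity
  push_cast
  field_simp
  ring

theorem brunelPowCoeff_succ_left (m p : ℕ) :
    brunelPowCoeff (m + 1) p = brunelPowCoeff m p *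
      (((m : ℝ) + 2) * (m + 1 + 2 * p) / (2 * (m + 1) * (m + p + 2))) := by
  unfold brunelPowCoeff
  rw [show m + 1 + 2 * p = (m + 2 * p) + 1 by ring,
    show m + 1 + 1 + p = (m + 1 + p) + 1 by ring,
    show m + 1 + 1 + 2 * p = m + 2 * p + 1 + 1 by ring, Nat.factorial_succ, Nat.factorial_succ,
    pow_succ _ (m + 2 * p + 1)]
  have : (m : ℝ) + p + 2 ≠ 0 := by positivity
  have : (m : ℝ) + 1 + p + 1 ≠ 0 := by positivity
  push_cast
  field_simp
  ring

theorem brunelPowCoeff_zero_left (p : ℕ) : brunelPowCoeff 0 p = catalan p / (2 * 4 ^ p) := by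
  rw [catalan_eq_centralBinom_div, Nat.cast_div (Nat.succ_dvd_centralBinom p) (by positivity),
    Nat.centralBinom_eq_two_mul_choose, Nat.cast_choose ℝ (by omega : p ≤ 2 * p)]
  unfold brunelPowCoeff
  rw [show 2 * p - p = p by omega, show 0 + 1 + p = p + 1 by ring, Nat.factorial_succ,
    show (4 : ℝ) = 2 ^ 2 by norm_num, ← pow_mul, show 0 + 1 + 2 * p = 2 * p + 1 by ring,
    pow_succ, zero_add]
  push_cast
  field_simp
  ring

theorem brunelPowCoeff_zero_right (m : ℕ) : brunelPowCoeff m 0 = (1 / 2) ^ (m + 1) := by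
  unfold brunelPowCoeff
  simp only [mul_zero, add_zero, Nat.factorial_succ, Nat.factorial_zero]
  push_cast
  field_simp
  simp

/-! ### Convolution identities through formal power series. -/

/-- The power series `ψ ^ (m + 1)`. -/
noncomputable def brunelPowSeries (m : ℕ) : PowerSeries ℝ :=
  PowerSeries.mk (brunelPowCoeff m)

/-- The case `m = 0` is a rescaled Catalan sequence, so this is the Catalan recursion. -/
theorem sum_antidiagonal_brunelPowCoeff_zero (p : ℕ) :
    ∑ ij ∈ antidiagonal p, brunelPowCoeff 0 ij.1 * brunelPowCoeff 0 ij.2 =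
      2 * brunelPowCoeff 0 (p + 1) := by
  have h : ∀ ij ∈ antidiagonal p, brunelPowCoeff 0 ij.1 * brunelPowCoeff 0 ij.2 =
      ((catalan ij.1 * catalan ij.2 : ℕ) : ℝ) * (1 / 4 ^ (p + 1)) := by
    intro ij hij
    rw [brunelPowCoeff_zero_left, brunelPowCoeff_zero_left, pow_succ,
      ← mem_antidiagonal.1 hij, pow_add]
    push_cast
    field_simp
    ring
  rw [Finset.sum_congr rfl h, ← Finset.sum_mul, ← Nat.cast_sum, ← catalan_succ',
    brunelPowCoeff_zero_left]
  field_simp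

theorem X_mul_brunelPowSeries_zero_sq :
    PowerSeries.X * brunelPowSeries 0 ^ 2 = 2 * brunelPowSeries 0 - 1 := by
  ext p
  rw [show (2 : PowerSeries ℝ) * brunelPowSeries 0 = brunelPowSeries 0 + brunelPowSeries 0 by ring]
  cases p with
  | zero =>
    simp [brunelPowSeries, brunelPowCoeff_zero_right]
    norm_num
  | succ p =>
    rw [mul_comm, PowerSeries.coeff_succ_mul_X, sq, PowerSeries.coeff_mul]
    simp only [brunelPowSeries, PowerSeries.coeff_mk, map_sub, map_add, PowerSeries.coeff_one]
    rw [sum_antidiagonal_brunelPowCoeff_zero]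
    simp
    ring

theorem X_mul_brunelPowSeries_one :
    PowerSeries.X * brunelPowSeries 1 = 2 * brunelPowSeries 0 - 1 := by
  ext p
  rw [show (2 : PowerSeries ℝ) * brunelPowSeries 0 = brunelPowSeries 0 + brunelPowSeries 0 by ring]
  cases p with
  | zero =>
    simp [brunelPowSeries, brunelPowCoeff_zero_right]
    norm_num
  | succ p =>
    rw [mul_comm, PowerSeries.coeff_succ_mul_X]
    simp only [brunelPowSeries, PowerSeries.coeff_mk, map_sub, map_add, PowerSeries.coeff_one]
    rw [brunelPowCoeff_succ_right, brunelPowCoeff_succ_left 0]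
    simp
    have : (p : ℝ) + 2 ≠ 0 := by positivity
    field_simp
    ring

theorem X_mul_brunelPowSeries_add_two (m : ℕ) :
    PowerSeries.X * brunelPowSeries (m + 2) = 2 * brunelPowSeries (m + 1) - brunelPowSeries m := by
  ext p
  rw [show (2 : PowerSeries ℝ) * brunelPowSeries (m + 1) =
    brunelPowSeries (m + 1) + brunelPowSeries (m + 1) by ring]
  cases p with
  | zero =>
    simp [brunelPowSeries, brunelPowCoeff_zero_right]
    ring
  | succ p =>
    rw [mul_comm, PowerSeries.coeff_succ_mul_X]
    simp only [brunelPowSeries, PowerSeries.coeff_mk, map_sub, map_add]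
    rw [brunelPowCoeff_succ_left (m + 1), brunelPowCoeff_succ_left m p,
      brunelPowCoeff_succ_left m (p + 1), brunelPowCoeff_succ_right m p]
    push_cast
    have : (m : ℝ) + p + 2 ≠ 0 := by positivity
    have : (m : ℝ) + 1 + p + 2 ≠ 0 := by positivity
    have : (m : ℝ) + (p + 1) + 2 ≠ 0 := by positivity
    field_simp
    ring

/-- Both sides satisfy the three-term recurrence obtained by multiplying `X ψ² = 2 ψ - 1` by a power
of `ψ`, and `X` can be cancelled. -/
theorem brunelPowSeries_eq_pow (m : ℕ) : brunelPowSeries m = brunelPowSeries 0 ^ (m + 1) := by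
  induction m using Nat.strong_induction_on with
  | _ m ih =>
    match m with
    | 0 => simp
    | 1 =>
      apply mul_left_cancel₀ (PowerSeries.X_ne_zero (R := ℝ))
      rw [X_mul_brunelPowSeries_one, X_mul_brunelPowSeries_zero_sq]
    | m + 2 =>
      apply mul_left_cancel₀ (PowerSeries.X_ne_zero (R := ℝ))
      rw [X_mul_brunelPowSeries_add_two, ih m (by omega), ih (m + 1) (by omega)]
      linear_combination -brunelPowSeries 0 ^ (m + 1) * X_mul_brunelPowSeries_zero_sq

theorem sum_antidiagonal_brunelPowCoeff (m p : ℕ) :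
    ∑ ij ∈ antidiagonal p, brunelPowCoeff m ij.1 * brunelPowCoeff 0 ij.2 =
      brunelPowCoeff (m + 1) p := by
  have h : brunelPowSeries (m + 1) = brunelPowSeries m * brunelPowSeries 0 := by
    rw [brunelPowSeries_eq_pow (m + 1), brunelPowSeries_eq_pow m, pow_succ]
  have := congrArg (PowerSeries.coeff p) h
  rw [PowerSeries.coeff_mul] at this
  simpa [brunelPowSeries] using this.symm

/-! ### Total mass and decay of the coefficients. -/

theorem sum_brunelPowCoeff_zero (P : ℕ) :
    ∑ p ∈ Finset.range P, brunelPowCoeff 0 p = 1 - 2 * (P + 1) * brunelPowCoeff 0 P := by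
  induction P with
  | zero => simp [brunelPowCoeff_zero_right]
  | succ P ih =>
    rw [Finset.sum_range_succ, ih, brunelPowCoeff_succ_right]
    push_cast
    have : (P : ℝ) + 2 ≠ 0 := by positivity
    simp only [zero_add]
    field_simp
    ring

theorem sum_brunelPowCoeff_succ_left (m P : ℕ) :
    ∑ p ∈ Finset.range P, brunelPowCoeff (m + 1) p =
      ∑ p ∈ Finset.range P, brunelPowCoeff m p - 2 * P / (m + 1) * brunelPowCoeff m P := by
  induction P with
  | zero => simp
  | succ P ih =>
    rw [Finset.sum_range_succ, Finset.sum_range_succ, ih, brunelPowCoeff_succ_right,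
      brunelPowCoeff_succ_left]
    push_cast
    have : (m : ℝ) + P + 2 ≠ 0 := by positivity
    field_simp
    ring

theorem sum_brunelPowCoeff_le_one (m P : ℕ) :
    ∑ p ∈ Finset.range P, brunelPowCoeff m p ≤ 1 := by
  induction m with
  | zero =>
    rw [sum_brunelPowCoeff_zero]
    have := brunelPowCoeff_pos 0 P
    have : 0 ≤ 2 * ((P : ℝ) + 1) * brunelPowCoeff 0 P := by positivity
    linarith
  | succ m ih =>
    rw [sum_brunelPowCoeff_succ_left]
    have := brunelPowCoeff_pos m P
    have : 0 ≤ 2 * P / ((m : ℝ) + 1) * brunelPowCoeff m P := by positivity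
    linarith

theorem brunelPowCoeff_le (m p : ℕ) : brunelPowCoeff m p ≤ (m + 1) * brunelPowCoeff 0 p := by
  induction m with
  | zero => simp
  | succ m ih =>
    rw [brunelPowCoeff_succ_left]
    have h0 := brunelPowCoeff_pos m p
    have h : ((m : ℝ) + 2) * (m + 1 + 2 * p) / (2 * (m + 1) * (m + p + 2)) ≤ (m + 2) / (m + 1) := by
      rw [div_le_div_iff₀ (by positivity) (by positivity)]
      have : 0 ≤ ((m : ℝ) + 2) * (m + 1) * (m + 3) := by positivity
      nlinarith
    have h1 := brunelPowCoeff_pos 0 p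
    calc _ ≤ (m + 1) * brunelPowCoeff 0 p * (((m : ℝ) + 2) / (m + 1)) := by gcongr
      _ = _ := by push_cast; field_simp; ring

/-- A Wallis-type bound: the left side decreases in `p`, its successive ratio being `(2p + 1)(2p +
3) / (2p + 2)²`. It gives decay of order `p ^ (-3/2)`. -/
theorem brunelPowCoeff_zero_sq_le (p : ℕ) :
    ((p + 1) * brunelPowCoeff 0 p) ^ 2 * (2 * p + 1) ≤ 1 := by
  induction p with
  | zero => simp [brunelPowCoeff_zero_right]; norm_num
  | succ p ih =>
    refine le_trans ?_ ih
    rw [brunelPowCoeff_succ_right]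
    push_cast
    have h2 : (p : ℝ) + 2 ≠ 0 := by positivity
    have e : (((p : ℝ) + 1 + 1) * (brunelPowCoeff 0 p * ((0 + 1 + 2 * p) * (0 + 2 * p + 2) /
        (4 * (p + 1) * (0 + p + 2))))) ^ 2 * (2 * (p + 1) + 1) =
        ((p + 1) * brunelPowCoeff 0 p) ^ 2 * (2 * p + 1) *
          ((2 * p + 1) * (2 * p + 3) / (2 * p + 2) ^ 2) := by
      simp only [zero_add]
      field_simp
      ring
    rw [e]
    apply mul_le_of_le_one_right (by positivity)
    rw [div_le_one (by positivity)]
    nlinarith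

theorem tendsto_mul_brunelPowCoeff (m : ℕ) :
    Tendsto (fun p : ℕ => (p : ℝ) * brunelPowCoeff m p) atTop (𝓝 0) := by
  have h1 : Tendsto (fun p : ℕ => ((m : ℝ) + 1) * √(1 / ((p : ℝ) + 1))) atTop (𝓝 0) := by
    have := (Real.continuous_sqrt.tendsto 0).comp (tendsto_one_div_add_atTop_nhds_zero_nat (𝕜 := ℝ))
    simpa using this.const_mul ((m : ℝ) + 1)
  refine squeeze_zero (fun p => ?_) (fun p => ?_) h1
  · have := brunelPowCoeff_pos m p
    positivity
  · have h0 := brunelPowCoeff_pos 0 p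
    have hs : ((p : ℝ) + 1) * brunelPowCoeff 0 p ≤ √(1 / ((p : ℝ) + 1)) := by
      apply Real.le_sqrt_of_sq_le
      rw [le_div_iff₀ (by positivity)]
      refine le_trans ?_ (brunelPowCoeff_zero_sq_le p)
      gcongr
      linarith [(Nat.cast_nonneg p : (0 : ℝ) ≤ p)]
    calc (p : ℝ) * brunelPowCoeff m p ≤ p * ((m + 1) * brunelPowCoeff 0 p) := by
          gcongr; exact brunelPowCoeff_le m p
      _ = (m + 1) * (p * brunelPowCoeff 0 p) := by ring
      _ ≤ (m + 1) * (((p : ℝ) + 1) * brunelPowCoeff 0 p) := by gcongr; linarith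
      _ ≤ _ := by gcongr

theorem mul_brunelPowCoeff_le (m p : ℕ) : (p : ℝ) * brunelPowCoeff m p ≤ m + 1 := by
  have h0 := brunelPowCoeff_pos 0 p
  have h1 := brunelPowCoeff_zero_sq_le p
  have h2 : ((p : ℝ) + 1) * brunelPowCoeff 0 p ≤ 1 := by
    apply (sq_le_one_iff₀ (by positivity)).1
    refine le_trans (le_mul_of_one_le_right (by positivity) ?_) h1
    linarith [(Nat.cast_nonneg p : (0 : ℝ) ≤ p)]
  calc (p : ℝ) * brunelPowCoeff m p ≤ p * ((m + 1) * brunelPowCoeff 0 p) := by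
        gcongr; exact brunelPowCoeff_le m p
    _ ≤ (m + 1) * (((p : ℝ) + 1) * brunelPowCoeff 0 p) := by
        rw [mul_left_comm]; gcongr; linarith
    _ ≤ (m + 1) * 1 := by gcongr
    _ = _ := mul_one _

/-! ### Weighted sums of the coefficients, uniformly in `m`. -/

theorem sum_brunelPowCoeff_div_eq (m P : ℕ) :
    ∑ p ∈ Finset.range P, brunelPowCoeff m p *
      ((((m : ℝ) + 1) * (m + 2) - 2 * p) / (m + p + 2)) = 4 * (P * brunelPowCoeff m P) := by
  induction P with
  | zero => simp
  | succ P ih =>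
    rw [Finset.sum_range_succ, ih, brunelPowCoeff_succ_right]
    push_cast
    have : (m : ℝ) + P + 2 ≠ 0 := by positivity
    field_simp
    ring

/-- Writing `2p = 2(m + p + 2) - (2m + 4)` in the telescoping identity leaves twice the total mass,
hence the 2, minus a nonnegative term. -/
theorem sum_brunelPowCoeff_div_le (m P : ℕ) :
    ((m : ℝ) + 1) * (m + 2) * ∑ p ∈ Finset.range P, brunelPowCoeff m p / (m + p + 2) ≤
      2 + 4 * (P * brunelPowCoeff m P) := by
  have h : ((m : ℝ) + 1) * (m + 2) * ∑ p ∈ Finset.range P, brunelPowCoeff m p / (m + p + 2) ≤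
      ∑ p ∈ Finset.range P, (2 * brunelPowCoeff m p + brunelPowCoeff m p *
        ((((m : ℝ) + 1) * (m + 2) - 2 * p) / (m + p + 2))) := by
    rw [Finset.mul_sum]
    refine Finset.sum_le_sum fun p _ => ?_
    have h0 := brunelPowCoeff_pos m p
    have : 0 ≤ brunelPowCoeff m p * ((2 * m + 4) / (m + p + 2)) := by positivity
    have e : 2 * brunelPowCoeff m p + brunelPowCoeff m p *
        ((((m : ℝ) + 1) * (m + 2) - 2 * p) / (m + p + 2)) =
        (m + 1) * (m + 2) * (brunelPowCoeff m p / (m + p + 2)) +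
        brunelPowCoeff m p * ((2 * m + 4) / (m + p + 2)) := by
      have : (m : ℝ) + p + 2 ≠ 0 := by positivity
      field_simp
      ring
    linarith
  rw [Finset.sum_add_distrib, ← Finset.mul_sum, sum_brunelPowCoeff_div_eq] at h
  linarith [sum_brunelPowCoeff_le_one m P]

theorem sum_brunelPowCoeff_div_div_eq (m P : ℕ) :
    ∑ p ∈ Finset.range P, brunelPowCoeff m p *
      ((((m : ℝ) + 1) * (m + 2) - 6 * p) / ((m + p + 2) * (m + p + 3))) =
        4 * (P * brunelPowCoeff m P) / (m + P + 2) := by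
  induction P with
  | zero => simp
  | succ P ih =>
    rw [Finset.sum_range_succ, ih, brunelPowCoeff_succ_right]
    push_cast
    have : (m : ℝ) + P + 2 ≠ 0 := by positivity
    have : (m : ℝ) + P + 3 ≠ 0 := by positivity
    have : (m : ℝ) + (P + 1) + 2 ≠ 0 := by positivity
    field_simp
    ring

theorem sum_brunelPowCoeff_div_div_le (m P : ℕ) :
    (((m : ℝ) + 1) * (m + 2)) ^ 2 *
        ∑ p ∈ Finset.range P, brunelPowCoeff m p / ((m + p + 2) * (m + p + 3)) ≤
      12 + (24 + 4 * (((m : ℝ) + 1) * (m + 2))) * (P * brunelPowCoeff m P) := by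
  set y : ℝ := ((m : ℝ) + 1) * (m + 2) with hy
  have hy0 : 0 ≤ y := by positivity
  have h : y * ∑ p ∈ Finset.range P, brunelPowCoeff m p / ((m + p + 2) * (m + p + 3)) ≤
      ∑ p ∈ Finset.range P, (6 * (brunelPowCoeff m p / (m + p + 2)) + brunelPowCoeff m p *
        ((y - 6 * p) / ((m + p + 2) * (m + p + 3)))) := by
    rw [Finset.mul_sum]
    refine Finset.sum_le_sum fun p _ => ?_
    have h0 := brunelPowCoeff_pos m p
    have : 0 ≤ brunelPowCoeff m p * ((6 * m + 18) / ((m + p + 2) * (m + p + 3))) := by positivity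
    have e : 6 * (brunelPowCoeff m p / (m + p + 2)) + brunelPowCoeff m p *
        ((y - 6 * p) / ((m + p + 2) * (m + p + 3))) =
        y * (brunelPowCoeff m p / ((m + p + 2) * (m + p + 3))) +
        brunelPowCoeff m p * ((6 * m + 18) / ((m + p + 2) * (m + p + 3))) := by
      have : (m : ℝ) + p + 2 ≠ 0 := by positivity
      have : (m : ℝ) + p + 3 ≠ 0 := by positivity
      field_simp
      ring
    linarith
  rw [Finset.sum_add_distrib, ← Finset.mul_sum, sum_brunelPowCoeff_div_div_eq] at h
  have h1 := sum_brunelPowCoeff_div_le m P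
  have hP := brunelPowCoeff_pos m P
  have h2 : 4 * (P * brunelPowCoeff m P) / (m + P + 2) ≤ 4 * (P * brunelPowCoeff m P) := by
    apply div_le_self (by positivity)
    linarith [(Nat.cast_nonneg P : (0 : ℝ) ≤ P), (Nat.cast_nonneg m : (0 : ℝ) ≤ m)]
  calc _ = y * (y * ∑ p ∈ Finset.range P, brunelPowCoeff m p / ((m + p + 2) * (m + p + 3))) := by
        ring
    _ ≤ y * (6 * ∑ p ∈ Finset.range P, brunelPowCoeff m p / (m + p + 2) +
          4 * (P * brunelPowCoeff m P)) := by gcongr; linarith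
    _ = 6 * (y * ∑ p ∈ Finset.range P, brunelPowCoeff m p / (m + p + 2)) +
          4 * y * (P * brunelPowCoeff m P) := by ring
    _ ≤ _ := by linarith

/-! ### Weighted variation of `b_m` and of `b_{m+1} - b_m`. -/

theorem sum_succ_mul_abs_sub_brunelPowCoeff_le (m P : ℕ) :
    ∑ p ∈ Finset.range P, ((p : ℝ) + 1) * |brunelPowCoeff m p - brunelPowCoeff m (p + 1)| ≤
      2 + P * brunelPowCoeff m P := by
  have h : ∀ p ∈ Finset.range P,
      ((p : ℝ) + 1) * |brunelPowCoeff m p - brunelPowCoeff m (p + 1)| ≤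
      3 / 2 * brunelPowCoeff m p +
        1 / 4 * (((m : ℝ) + 1) * (m + 2)) * (brunelPowCoeff m p / (m + p + 2)) := by
    intro p _
    have h0 := brunelPowCoeff_pos m p
    have e : ((p : ℝ) + 1) * (brunelPowCoeff m p - brunelPowCoeff m (p + 1)) =
        brunelPowCoeff m p * ((m + 6 * p + 6 - m ^ 2) / (4 * (m + p + 2))) := by
      rw [brunelPowCoeff_succ_right]
      have : (m : ℝ) + p + 2 ≠ 0 := by positivity
      field_simp
      ring
    have e' : 3 / 2 * brunelPowCoeff m p +
        1 / 4 * (((m : ℝ) + 1) * (m + 2)) * (brunelPowCoeff m p / (m + p + 2)) =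
        brunelPowCoeff m p * ((6 * (m + p + 2) + (m + 1) * (m + 2)) / (4 * (m + p + 2))) := by
      have : (m : ℝ) + p + 2 ≠ 0 := by positivity
      field_simp
      ring
    rw [← abs_of_nonneg (by positivity : (0 : ℝ) ≤ p + 1), ← abs_mul, e, e', abs_mul, abs_of_pos h0, abs_div,
      abs_of_pos (by positivity : (0 : ℝ) < 4 * (m + p + 2))]
    gcongr
    rw [abs_le]
    have hm : (0 : ℝ) ≤ m := by positivity
    have hp : (0 : ℝ) ≤ p := by positivity
    constructor <;> nlinarith
  refine (Finset.sum_le_sum h).trans ?_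
  rw [Finset.sum_add_distrib, ← Finset.mul_sum, ← Finset.mul_sum]
  -- The constant is `3/2 · 1 + 1/4 · 2 = 2`.
  linarith [sum_brunelPowCoeff_le_one m P, sum_brunelPowCoeff_div_le m P]

theorem sum_succ_mul_abs_sub_sub_brunelPowCoeff_le (m P : ℕ) :
    ((m : ℝ) + 1) * ∑ p ∈ Finset.range P, ((p : ℝ) + 1) *
        |(brunelPowCoeff (m + 1) p - brunelPowCoeff m p) -
          (brunelPowCoeff (m + 1) (p + 1) - brunelPowCoeff m (p + 1))| ≤
      9 + (15 + ((m : ℝ) + 1) * (m + 2)) * (P * brunelPowCoeff m P) := by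
  rw [Finset.mul_sum]
  have h : ∀ p ∈ Finset.range P, ((m : ℝ) + 1) * (((p : ℝ) + 1) *
      |(brunelPowCoeff (m + 1) p - brunelPowCoeff m p) -
          (brunelPowCoeff (m + 1) (p + 1) - brunelPowCoeff m (p + 1))|) ≤
      3 / 2 * brunelPowCoeff m p +
        9 / 4 * (((m : ℝ) + 1) * (m + 2)) * (brunelPowCoeff m p / (m + p + 2)) +
        1 / 4 * (((m : ℝ) + 1) * (m + 2)) ^ 2 *
          (brunelPowCoeff m p / ((m + p + 2) * (m + p + 3))) := by
    intro p _
    have h0 := brunelPowCoeff_pos m p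
    have hm : (0 : ℝ) ≤ m := by positivity
    have hp : (0 : ℝ) ≤ p := by positivity
    obtain ⟨y, hy⟩ : ∃ y : ℝ, y = ((m : ℝ) + 1) * (m + 2) := ⟨_, rfl⟩
    obtain ⟨s, hs⟩ : ∃ s : ℝ, s = (m : ℝ) + p + 2 := ⟨_, rfl⟩
    have e : ((m : ℝ) + 1) * (((p : ℝ) + 1) *
        ((brunelPowCoeff (m + 1) p - brunelPowCoeff m p) -
          (brunelPowCoeff (m + 1) (p + 1) - brunelPowCoeff m (p + 1)))) =
        brunelPowCoeff m p * (-((2 * p - y) * (m ^ 2 + m - 6 * p - 6) +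
          2 * (m + 1) * (2 * m * s - (m ^ 2 - m - 6 * p - 6))) / (8 * (s * (s + 1)))) := by
      rw [brunelPowCoeff_succ_left, brunelPowCoeff_succ_left, brunelPowCoeff_succ_right, hy, hs]
      push_cast
      have : (m : ℝ) + p + 2 ≠ 0 := by positivity
      have : (m : ℝ) + p + 2 + 1 ≠ 0 := by positivity
      have : (m : ℝ) + (p + 1) + 2 ≠ 0 := by positivity
      field_simp
      ring
    have e' : 3 / 2 * brunelPowCoeff m p +
        9 / 4 * y * (brunelPowCoeff m p / s) +
        1 / 4 * y ^ 2 * (brunelPowCoeff m p / (s * (s + 1))) =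
        brunelPowCoeff m p * ((12 * (s * (s + 1)) + 18 * y * (s + 1) + 2 * y ^ 2) /
          (8 * (s * (s + 1)))) := by
      have : s ≠ 0 := by rw [hs]; positivity
      have : s + 1 ≠ 0 := by rw [hs]; positivity
      field_simp
      ring
    rw [show (m : ℝ) + p + 3 = s + 1 by rw [hs]; ring, ← hs, ← hy, e', ← mul_assoc,
      ← abs_of_nonneg (by positivity : (0 : ℝ) ≤ (m + 1) * (p + 1)), ← abs_mul, mul_assoc,
      e, abs_mul, abs_of_pos h0, abs_div,
      abs_of_pos (by rw [hs]; positivity : (0 : ℝ) < 8 * (s * (s + 1))), abs_neg]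
    have hs0 : 0 < s := by rw [hs]; positivity
    have hy0 : 0 < y := by rw [hy]; positivity
    gcongr
    have a1 : |2 * (p : ℝ) - y| ≤ 2 * s + y := by
      rw [abs_le]; constructor <;> linarith
    have a2 : |(m : ℝ) ^ 2 + m - 6 * p - 6| ≤ y + 6 * s := by
      rw [abs_le]; constructor <;> nlinarith
    have a3 : |(m : ℝ) ^ 2 - m - 6 * p - 6| ≤ y + 6 * s := by
      rw [abs_le]; constructor <;> nlinarith
    have a4 : |2 * (m : ℝ) * s - (m ^ 2 - m - 6 * p - 6)| ≤ 2 * m * s + (y + 6 * s) := by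
      refine (abs_sub _ _).trans ?_
      rw [abs_of_nonneg (by positivity : (0 : ℝ) ≤ 2 * m * s)]
      linarith
    have hmy : 2 * ((m : ℝ) + 1) ≤ y := by rw [hy]; nlinarith
    have hmy' : 2 * ((m : ℝ) + 1) * (2 * m) ≤ 4 * y := by rw [hy]; nlinarith
    refine (abs_add_le _ _).trans ?_
    rw [abs_mul, abs_mul (2 * ((m : ℝ) + 1)),
      abs_of_nonneg (by positivity : (0 : ℝ) ≤ 2 * (m + 1))]
    calc _ ≤ (2 * s + y) * (y + 6 * s) + 2 * ((m : ℝ) + 1) * (2 * m * s + (y + 6 * s)) := by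
          gcongr
      _ = (2 * s + y) * (y + 6 * s) + 2 * ((m : ℝ) + 1) * (2 * m) * s +
          2 * ((m : ℝ) + 1) * (y + 6 * s) := by ring
      _ ≤ (2 * s + y) * (y + 6 * s) + 4 * y * s + y * (y + 6 * s) := by gcongr
      _ ≤ _ := by nlinarith
  refine (Finset.sum_le_sum h).trans ?_
  rw [Finset.sum_add_distrib, Finset.sum_add_distrib, ← Finset.mul_sum, ← Finset.mul_sum,
    ← Finset.mul_sum]
  -- The constant is `3/2 · 1 + 9/4 · 2 + 1/4 · 12 = 9`.
  linarith [sum_brunelPowCoeff_le_one m P, sum_brunelPowCoeff_div_le m P,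
    sum_brunelPowCoeff_div_div_le m P]

/-! ### Identification with the Taylor coefficients of `ψ`. -/

theorem summable_brunelPowCoeff (m : ℕ) : Summable (brunelPowCoeff m) :=
  summable_of_sum_range_le (fun p => (brunelPowCoeff_pos m p).le) (sum_brunelPowCoeff_le_one m)

theorem hasSum_pow_mul_brunelPowCoeff_zero {x : ℝ} (hx : |x| < 1) :
    HasSum (fun p => x ^ p * brunelPowCoeff 0 p) (brunelPsi x) := by
  have hb := summable_brunelPowCoeff 0
  have hle : ∀ p, ‖x ^ p * brunelPowCoeff 0 p‖ ≤ brunelPowCoeff 0 p := fun p => by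
    rw [norm_mul, norm_pow, Real.norm_eq_abs, Real.norm_eq_abs, abs_of_pos (brunelPowCoeff_pos 0 p)]
    exact mul_le_of_le_one_left (brunelPowCoeff_pos 0 p).le (pow_le_one₀ (abs_nonneg x) hx.le)
  have hn : Summable fun p => ‖x ^ p * brunelPowCoeff 0 p‖ :=
    Summable.of_nonneg_of_le (fun _ => norm_nonneg _) hle hb
  have hs := hn.of_norm
  obtain ⟨g, hg⟩ : ∃ g, g = ∑' p, x ^ p * brunelPowCoeff 0 p := ⟨_, rfl⟩
  have hg1 : |g| ≤ 1 := by
    rw [hg]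
    exact (norm_tsum_le_tsum_norm hn).trans ((hn.tsum_le_tsum hle hb).trans
      (Real.tsum_le_of_sum_range_le (fun p => (brunelPowCoeff_pos 0 p).le)
        (sum_brunelPowCoeff_le_one 0)))
  have hsq : g * g = ∑' p, 2 * (x ^ p * brunelPowCoeff 0 (p + 1)) := by
    rw [hg, tsum_mul_tsum_eq_tsum_sum_antidiagonal_of_summable_norm hn hn]
    refine tsum_congr fun p => ?_
    have : ∀ ij ∈ antidiagonal p, x ^ ij.1 * brunelPowCoeff 0 ij.1 *
        (x ^ ij.2 * brunelPowCoeff 0 ij.2) =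
        x ^ p * (brunelPowCoeff 0 ij.1 * brunelPowCoeff 0 ij.2) := by
      intro ij hij
      rw [← mem_antidiagonal.1 hij, pow_add]
      ring
    rw [Finset.sum_congr rfl this, ← Finset.mul_sum, sum_antidiagonal_brunelPowCoeff_zero]
    ring
  have hquad : x * (g * g) = 2 * g - 1 := by
    have h0 := hs.tsum_eq_zero_add
    rw [← hg, brunelPowCoeff_zero_right] at h0
    rw [hsq, ← tsum_mul_left, h0]
    have : ∀ p, x * (2 * (x ^ p * brunelPowCoeff 0 (p + 1))) =
        2 * (x ^ (p + 1) * brunelPowCoeff 0 (p + 1)) := fun p => by ring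
    rw [tsum_congr this, tsum_mul_left]
    ring
  have hval : brunelPsi x = g := by
    unfold brunelPsi
    split_ifs with h
    · subst h; linarith
    -- The quadratic equation gives `(1 - x g)² = 1 - x`; the bound on `x g` selects the nonnegative
    -- root.
    · have hxg : |x * g| ≤ 1 := by
        rw [abs_mul]; exact mul_le_one₀ hx.le (abs_nonneg _) hg1
      have : √(1 - x) = 1 - x * g := by
        rw [show 1 - x = (1 - x * g) ^ 2 by linear_combination -x * hquad]
        exact Real.sqrt_sq (by linarith [(abs_le.1 hxg).2])
      rw [this]
      field_simp
      ring
  rw [hval, hg]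
  exact hs.hasSum

theorem brunelCoeff_eq (p : ℕ) : brunelCoeff p = brunelPowCoeff 0 p := by
  have h : HasFPowerSeriesAt brunelPsi
      (FormalMultilinearSeries.ofScalars ℝ (brunelPowCoeff 0)) 0 := by
    rw [hasFPowerSeriesAt_iff]
    filter_upwards [Metric.ball_mem_nhds (0 : ℝ) one_pos] with x hx
    rw [mem_ball_zero_iff, Real.norm_eq_abs] at hx
    simpa using hasSum_pow_mul_brunelPowCoeff_zero hx
  have h2 := h.analyticAt.hasFPowerSeriesAt.eq_formalMultilinearSeries h
  have := congrArg (fun q => FormalMultilinearSeries.coeff q p) h2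
  simpa [brunelCoeff] using this

section CauchyProduct

theorem sum_antidiagonal_mul_sum_range {R : Type*} [NonUnitalNonAssocSemiring R] (f g : ℕ → R)
    (N : ℕ) :
    ∑ ij ∈ antidiagonal N, f ij.1 * ∑ k ∈ Finset.range (ij.2 + 1), g k =
      ∑ n ∈ Finset.range (N + 1), ∑ ij ∈ antidiagonal n, f ij.1 * g ij.2 := by
  induction N with
  | zero => simp
  | succ N ih =>
    rw [Finset.sum_range_succ, ← ih, Finset.Nat.sum_antidiagonal_succ',
      Finset.Nat.sum_antidiagonal_succ' (f := fun ij => f ij.1 * g ij.2)]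
    simp only [Finset.sum_range_succ _ (_ + 1), mul_add, Finset.sum_add_distrib]
    simp
    abel

/-- In generating functions, `(f / (1 - x)) (g / (1 - x)) = (f g) / (1 - x)²`. -/
theorem sum_antidiagonal_sum_range_mul_sum_range {R : Type*} [NonUnitalNonAssocSemiring R]
    (f g : ℕ → R) (N : ℕ) :
    ∑ ij ∈ antidiagonal N,
        (∑ k ∈ Finset.range (ij.1 + 1), f k) * ∑ k ∈ Finset.range (ij.2 + 1), g k =
      ∑ M ∈ Finset.range (N + 1), ∑ n ∈ Finset.range (M + 1),
        ∑ ij ∈ antidiagonal n, f ij.1 * g ij.2 := by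
  induction N with
  | zero => simp
  | succ N ih =>
    rw [Finset.sum_range_succ, ← ih, ← sum_antidiagonal_mul_sum_range,
      Finset.Nat.sum_antidiagonal_succ,
      Finset.Nat.sum_antidiagonal_succ (f := fun ij => f ij.1 * ∑ k ∈ Finset.range (ij.2 + 1), g k)]
    simp only [Finset.sum_range_succ _ (_ + 1), add_mul, Finset.sum_add_distrib]
    simp
    abel

/-- Abel's theorem on Cauchy products: if two series and their Cauchy product converge, then
the sum of the Cauchy product is the product of the sums. -/
theorem mul_eq_of_tendsto_cauchyProduct (𝕜 : Type*) {R : Type*} [RCLike 𝕜] [NormedRing R]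
    [NormedSpace 𝕜 R] {f g : ℕ → R} {a b c : R}
    (hf : Tendsto (fun N => ∑ n ∈ Finset.range (N + 1), f n) atTop (𝓝 a))
    (hg : Tendsto (fun N => ∑ n ∈ Finset.range (N + 1), g n) atTop (𝓝 b))
    (hfg : Tendsto (fun N => ∑ n ∈ Finset.range (N + 1), ∑ ij ∈ antidiagonal n, f ij.1 * g ij.2)
      atTop (𝓝 c)) :
    a * b = c := by
  obtain ⟨F, hF⟩ : ∃ F : ℕ → R, F = fun N => ∑ n ∈ Finset.range (N + 1), f n := ⟨_, rfl⟩
  obtain ⟨G, hG⟩ : ∃ G : ℕ → R, G = fun N => ∑ n ∈ Finset.range (N + 1), g n := ⟨_, rfl⟩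
  obtain ⟨H, hH⟩ : ∃ H : ℕ → R, H = fun N =>
    ∑ n ∈ Finset.range (N + 1), ∑ ij ∈ antidiagonal n, f ij.1 * g ij.2 := ⟨_, rfl⟩
  rw [← hF] at hf
  rw [← hG] at hg
  rw [← hH] at hfg
  -- Divided by `N + 1`, the left side tends to `a * b` and the right side, a Cesàro mean, to `c`.
  have key : ∀ N, ∑ ij ∈ antidiagonal N, F ij.1 * G ij.2 = ∑ M ∈ Finset.range (N + 1), H M := by
    intro N
    rw [hF, hG, hH]
    exact sum_antidiagonal_sum_range_mul_sum_range f g N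
  obtain ⟨B, hB⟩ := hg.norm.bddAbove_range
  have hB : ∀ j, ‖G j‖ ≤ B := fun j => hB ⟨j, rfl⟩
  have ces : ∀ {u : ℕ → R} {l : R}, Tendsto u atTop (𝓝 l) → Tendsto (fun N : ℕ =>
      (((N + 1 : ℕ) : ℝ))⁻¹ * ∑ i ∈ Finset.range (N + 1), ‖u i - l‖) atTop (𝓝 0) :=
    fun h => ((tendsto_iff_norm_sub_tendsto_zero.1 h).cesaro).comp (tendsto_add_atTop_nat 1)
  have hlim := (((ces hf).mul_const B).add ((ces hg).const_mul ‖a‖)).add (ces hfg)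
  simp only [zero_mul, mul_zero, add_zero] at hlim
  have hle : ‖a * b - c‖ ≤ 0 := by
    refine ge_of_tendsto' hlim fun N => ?_
    have hN : (0 : ℝ) < ((N + 1 : ℕ) : ℝ) := by positivity
    have e : (N + 1) • (a * b - c) = (∑ M ∈ Finset.range (N + 1), (H M - c)) -
        ∑ ij ∈ antidiagonal N, ((F ij.1 - a) * G ij.2 + a * (G ij.2 - b)) := by
      have : ∀ ij : ℕ × ℕ, (F ij.1 - a) * G ij.2 + a * (G ij.2 - b) = F ij.1 * G ij.2 - a * b :=
        fun ij => by noncomm_ring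
      simp only [this, Finset.sum_sub_distrib, key, Finset.sum_const, Finset.card_range,
        Finset.Nat.card_antidiagonal, smul_sub]
      abel
    have e1 : ((N + 1 : ℕ) : ℝ) * ‖a * b - c‖ = ‖(N + 1) • (a * b - c)‖ := by
      rw [← Nat.cast_smul_eq_nsmul 𝕜, norm_smul, RCLike.norm_natCast]
    have e2 : ∑ ij ∈ antidiagonal N, ‖F ij.1 - a‖ = ∑ i ∈ Finset.range (N + 1), ‖F i - a‖ :=
      Finset.Nat.sum_antidiagonal_eq_sum_range_succ (fun i _ => ‖F i - a‖) N
    have e3 : ∑ ij ∈ antidiagonal N, ‖G ij.2 - b‖ = ∑ i ∈ Finset.range (N + 1), ‖G i - b‖ := by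
      rw [← Finset.Nat.sum_antidiagonal_swap]
      exact Finset.Nat.sum_antidiagonal_eq_sum_range_succ (fun i _ => ‖G i - b‖) N
    have h1 : ‖∑ ij ∈ antidiagonal N, ((F ij.1 - a) * G ij.2 + a * (G ij.2 - b))‖ ≤
        (∑ i ∈ Finset.range (N + 1), ‖F i - a‖) * B +
          ‖a‖ * ∑ i ∈ Finset.range (N + 1), ‖G i - b‖ := by
      rw [← e2, ← e3, Finset.sum_mul, Finset.mul_sum, ← Finset.sum_add_distrib]
      refine norm_sum_le_of_le _ fun ij _ => (norm_add_le _ _).trans ?_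
      gcongr
      · exact (norm_mul_le _ _).trans (by gcongr; exact hB _)
      · exact norm_mul_le _ _
    have h2 : ((N + 1 : ℕ) : ℝ) * ‖a * b - c‖ ≤
        (∑ i ∈ Finset.range (N + 1), ‖F i - a‖) * B +
          ‖a‖ * ∑ i ∈ Finset.range (N + 1), ‖G i - b‖ +
          ∑ i ∈ Finset.range (N + 1), ‖H i - c‖ := by
      rw [e1, e]
      refine (norm_sub_le _ _).trans ?_
      linarith [norm_sum_le (Finset.range (N + 1)) (fun M => H M - c)]
    rw [← mul_le_mul_iff_right₀ hN]
    refine h2.trans_eq ?_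
    field_simp
  exact sub_eq_zero.1 (norm_le_zero_iff.1 hle)

end CauchyProduct

/-! ### Summation by parts against linearly growing partial sums. -/

section Abel

variable {𝕜 V : Type*} [RCLike 𝕜] [NormedAddCommGroup V] [NormedSpace 𝕜 V]

theorem sum_range_smul_eq_abel (a : ℕ → ℝ) (v : ℕ → V) (P : ℕ) :
    ∑ p ∈ Finset.range P, (a p : 𝕜) • v p =
      ∑ p ∈ Finset.range P, ((a p - a (p + 1) : ℝ) : 𝕜) • ∑ k ∈ Finset.range (p + 1), v k +
        (a P : 𝕜) • ∑ k ∈ Finset.range P, v k := by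
  induction P with
  | zero => simp
  | succ P ih =>
    rw [Finset.sum_range_succ, ih, Finset.sum_range_succ _ P, Finset.sum_range_succ v P]
    push_cast
    module

theorem norm_sub_smul_sum_le {v : ℕ → V} {M : ℝ}
    (hv : ∀ P : ℕ, ‖∑ k ∈ Finset.range P, v k‖ ≤ M * P) (a : ℕ → ℝ) (p : ℕ) :
    ‖((a p - a (p + 1) : ℝ) : 𝕜) • ∑ k ∈ Finset.range (p + 1), v k‖ ≤
      M * (((p : ℝ) + 1) * |a p - a (p + 1)|) := by
  rw [norm_smul, RCLike.norm_ofReal]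
  calc _ ≤ |a p - a (p + 1)| * (M * (p + 1 : ℕ)) := by gcongr; exact hv _
    _ = _ := by push_cast; ring

theorem norm_sum_range_smul_le {v : ℕ → V} {M : ℝ}
    (hv : ∀ P : ℕ, ‖∑ k ∈ Finset.range P, v k‖ ≤ M * P) (a : ℕ → ℝ) (P : ℕ) :
    ‖∑ p ∈ Finset.range P, (a p : 𝕜) • v p‖ ≤
      M * (∑ p ∈ Finset.range P, ((p : ℝ) + 1) * |a p - a (p + 1)| + P * |a P|) := by
  rw [sum_range_smul_eq_abel, mul_add, Finset.mul_sum]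
  refine (norm_add_le _ _).trans (add_le_add (norm_sum_le_of_le _ fun p _ =>
    norm_sub_smul_sum_le hv a p) ?_)
  rw [norm_smul, RCLike.norm_ofReal]
  calc _ ≤ |a P| * (M * P) := by gcongr; exact hv _
    _ = _ := by ring

theorem exists_tendsto_sum_range_smul [CompleteSpace V] {v : ℕ → V} {M : ℝ}
    (hv : ∀ P : ℕ, ‖∑ k ∈ Finset.range P, v k‖ ≤ M * P) (a : ℕ → ℝ)
    (ha : Summable fun p : ℕ => ((p : ℝ) + 1) * |a p - a (p + 1)|)
    (ha0 : Tendsto (fun p : ℕ => (p : ℝ) * a p) atTop (𝓝 0)) :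
    ∃ l : V, Tendsto (fun P => ∑ p ∈ Finset.range P, (a p : 𝕜) • v p) atTop (𝓝 l) := by
  have h1 := (Summable.of_norm_bounded (ha.mul_left M)
    (norm_sub_smul_sum_le (𝕜 := 𝕜) hv a)).hasSum.tendsto_sum_nat
  have h2 : Tendsto (fun P : ℕ => (a P : 𝕜) • ∑ k ∈ Finset.range P, v k) atTop (𝓝 0) := by
    have h3 := (ha0.abs.const_mul M)
    simp only [abs_zero, mul_zero] at h3
    refine squeeze_zero_norm (fun P => ?_) h3
    rw [norm_smul, RCLike.norm_ofReal, abs_mul, Nat.abs_cast]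
    calc _ ≤ |a P| * (M * P) := by gcongr; exact hv _
      _ = _ := by ring
  exact ⟨_, (h1.add h2).congr fun P => (sum_range_smul_eq_abel a v P).symm⟩

end Abel

/-! ### Operator series for the powers of `A`. -/

section Operator

variable {𝕜 X : Type*} [RCLike 𝕜] [NormedAddCommGroup X] [NormedSpace 𝕜 X]

theorem IsMeanBounded.exists_norm_sum_pow_le {T : X →L[𝕜] X} (hT : IsMeanBounded T) :
    ∃ M : ℝ, ∀ P : ℕ, ‖∑ k ∈ Finset.range P, T ^ k‖ ≤ M * P := by
  obtain ⟨M, hM⟩ := hT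
  refine ⟨M, fun P => ?_⟩
  rcases P.eq_zero_or_pos with rfl | hP
  · simp
  · have h := hM P hP
    rw [cesaroMean, norm_smul, norm_inv, RCLike.norm_natCast] at h
    have : (0 : ℝ) < P := by exact_mod_cast hP
    rwa [inv_mul_le_iff₀ this, mul_comm] at h

theorem summable_succ_mul_abs_sub_brunelPowCoeff (m : ℕ) :
    Summable fun p : ℕ => ((p : ℝ) + 1) * |brunelPowCoeff m p - brunelPowCoeff m (p + 1)| :=
  summable_of_sum_range_le (fun p => by positivity) fun P =>
    (sum_succ_mul_abs_sub_brunelPowCoeff_le m P).trans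
      (add_le_add_right (mul_brunelPowCoeff_le m P) 2)

theorem IsMeanBounded.exists_tendsto_brunelPowCoeff [CompleteSpace X] {T : X →L[𝕜] X}
    (hT : IsMeanBounded T) (m : ℕ) : ∃ A : X →L[𝕜] X,
      Tendsto (fun P => ∑ p ∈ Finset.range P, (brunelPowCoeff m p : 𝕜) • T ^ p) atTop (𝓝 A) := by
  obtain ⟨M, hM⟩ := hT.exists_norm_sum_pow_le
  exact exists_tendsto_sum_range_smul hM _ (summable_succ_mul_abs_sub_brunelPowCoeff m)
    (tendsto_mul_brunelPowCoeff m)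

theorem IsMeanBounded.tendsto_brunelPowCoeff_pow [CompleteSpace X] {T A : X →L[𝕜] X}
    (hT : IsMeanBounded T)
    (hA : Tendsto (fun P => ∑ p ∈ Finset.range P, (brunelPowCoeff 0 p : 𝕜) • T ^ p) atTop (𝓝 A))
    (m : ℕ) :
    Tendsto (fun P => ∑ p ∈ Finset.range P, (brunelPowCoeff m p : 𝕜) • T ^ p)
      atTop (𝓝 (A ^ (m + 1))) := by
  induction m with
  | zero => simpa using hA
  | succ m ih =>
    obtain ⟨C, hC⟩ := hT.exists_tendsto_brunelPowCoeff (m + 1)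
    have h := mul_eq_of_tendsto_cauchyProduct 𝕜 (c := C) (ih.comp (tendsto_add_atTop_nat 1))
      (hA.comp (tendsto_add_atTop_nat 1)) ?_
    · rwa [pow_succ, h]
    · refine (hC.comp (tendsto_add_atTop_nat 1)).congr fun N =>
        Finset.sum_congr rfl fun p _ => ?_
      rw [← sum_antidiagonal_brunelPowCoeff, RCLike.ofReal_sum, Finset.sum_smul]
      refine Finset.sum_congr rfl fun ij hij => ?_
      rw [← mem_antidiagonal.1 hij, pow_add, smul_mul_smul_comm, RCLike.ofReal_mul]

theorem IsBrunelOperator.unique {T A B : X →L[𝕜] X} (hA : IsBrunelOperator T A)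
    (hB : IsBrunelOperator T B) : A = B :=
  ContinuousLinearMap.ext fun f => tendsto_nhds_unique (hA f) (hB f)

theorem isBrunelOperator_of_tendsto {T A : X →L[𝕜] X}
    (hA : Tendsto (fun P => ∑ p ∈ Finset.range P, (brunelPowCoeff 0 p : 𝕜) • T ^ p) atTop (𝓝 A)) :
    IsBrunelOperator T A := by
  intro f
  have h := (((ContinuousLinearMap.apply 𝕜 X f).continuous.tendsto A).comp hA).comp
    (tendsto_add_atTop_nat 1)
  refine h.congr fun N => ?_
  simp [brunelCoeff_eq]

end Operator

theorem mainTheorem1 {𝕜 X : Type*} [RCLike 𝕜] [NormedAddCommGroup X] [NormedSpace 𝕜 X]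
    [CompleteSpace X] (T : X →L[𝕜] X) (hT : IsMeanBounded T) :
    (∃! A : X →L[𝕜] X, IsBrunelOperator T A) ∧
      ∀ A : X →L[𝕜] X, IsBrunelOperator T A →
        IsPowerBounded A ∧ ∃ C : ℝ, ∀ n : ℕ, (n : ℝ) * ‖A ^ (n + 1) - A ^ n‖ ≤ C := by
  obtain ⟨A₀, hA₀⟩ := hT.exists_tendsto_brunelPowCoeff 0
  have hB := isBrunelOperator_of_tendsto hA₀
  refine ⟨⟨A₀, hB, fun A hA => hA.unique hB⟩, fun A hA => ?_⟩
  obtain rfl := hA.unique hB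
  obtain ⟨M, hM⟩ := hT.exists_norm_sum_pow_le
  have hM0 : 0 ≤ M := by simpa using (norm_nonneg _).trans (hM 1)
  have hpow := hT.tendsto_brunelPowCoeff_pow hA₀
  constructor
  -- The first entry of the maximum serves only `n = 0`.
  · refine ⟨max ‖(1 : X →L[𝕜] X)‖ (M * 2), fun n => ?_⟩
    cases n with
    | zero => simp
    | succ m =>
      refine le_trans ?_ (le_max_right _ _)
      have hlim : Tendsto (fun P : ℕ => M * (2 + 2 * (P * brunelPowCoeff m P))) atTop
          (𝓝 (M * 2)) := by
        simpa using (((tendsto_mul_brunelPowCoeff m).const_mul 2).const_add 2).const_mul M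
      refine le_of_tendsto_of_tendsto' (hpow m).norm hlim fun P => ?_
      refine (norm_sum_range_smul_le hM _ P).trans ?_
      refine mul_le_mul_of_nonneg_left ?_ hM0
      rw [abs_of_pos (brunelPowCoeff_pos m P)]
      linarith [sum_succ_mul_abs_sub_brunelPowCoeff_le m P]
  · refine ⟨M * 9, fun n => ?_⟩
    cases n with
    | zero => simpa using hM0
    | succ m =>
      have h1 := tendsto_mul_brunelPowCoeff m
      have h2 := tendsto_mul_brunelPowCoeff (m + 1)
      -- The remainders have factors growing with `m`, but `m` is fixed while `P → ∞`, so only the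
      -- uniform 9 survives.
      have hlim : Tendsto (fun P : ℕ => M * (9 + (15 + ((m : ℝ) + 1) * (m + 2)) *
          (P * brunelPowCoeff m P) + ((m : ℝ) + 1) *
            |P * brunelPowCoeff (m + 1) P - P * brunelPowCoeff m P|)) atTop (𝓝 (M * 9)) := by
        simpa using (((h1.const_mul (15 + ((m : ℝ) + 1) * (m + 2))).const_add 9).add
          ((h2.sub h1).abs.const_mul ((m : ℝ) + 1))).const_mul M
      refine le_of_tendsto_of_tendsto'
        ((((hpow (m + 1)).sub (hpow m)).norm).const_mul ((m + 1 : ℕ) : ℝ)) hlim fun P => ?_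
      rw [← Finset.sum_sub_distrib]
      have e : ∀ p, (brunelPowCoeff (m + 1) p : 𝕜) • T ^ p - (brunelPowCoeff m p : 𝕜) • T ^ p =
          ((brunelPowCoeff (m + 1) p - brunelPowCoeff m p : ℝ) : 𝕜) • T ^ p := fun p => by
        rw [RCLike.ofReal_sub, sub_smul]
      simp only [e]
      have h3 := norm_sum_range_smul_le (𝕜 := 𝕜) hM
        (fun p => brunelPowCoeff (m + 1) p - brunelPowCoeff m p) P
      have h4 := sum_succ_mul_abs_sub_sub_brunelPowCoeff_le m P
      rw [Nat.cast_succ]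
      calc _ ≤ ((m : ℝ) + 1) * _ := mul_le_mul_of_nonneg_left h3 (by positivity)
        _ = M * (((m : ℝ) + 1) * ∑ p ∈ Finset.range P, ((p : ℝ) + 1) *
            |(brunelPowCoeff (m + 1) p - brunelPowCoeff m p) -
              (brunelPowCoeff (m + 1) (p + 1) - brunelPowCoeff m (p + 1))| + (m + 1) *
            |P * brunelPowCoeff (m + 1) P - P * brunelPowCoeff m P|) := by
          rw [← mul_sub, abs_mul, Nat.abs_cast]; ring
        _ ≤ _ := by gcongr
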